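/- Let $\mathbb O$ be the octonions with basis $1,i,j,k,l,il,jl,kl$, multiplied by the rules $a(bl)=(ba)l$, $(al)b=(a\bar b)l$, $(al)(bl)=-\bar b a$ for quaternions $a,b$. Identify $\mathbb R^7=\mathrm{Im}(\mathbb O)$, with the Euclidean inner product for which $i,j,k,l,il,jl,kl$ is orthonormal and with the cross product $x\times y=\frac12(\bar y x-\bar x y)$. Let $J,S\subset\mathbb R$ be open intervals, $s_0\in S$, and let $\gamma:J\times S\to\mathbb R^7$, $(t,s)\mapsto\gamma(t,s)$, be a smooth map such that $|\gamma_s|=1$, $k_1:=|\gamma_{ss}|>0$ and $$\gamma_t=\gamma_s\times\gamma_{ss}$$ on $J\times S$; let $\Sigma$ be the immersed surface swept out by $\gamma$. For every $t$ the curve $\gamma(t,\cdot)$ carries the $G_2$-frame $$I_4=\gamma_s,\quad I_1=\tfrac1{k_1}I_{4s},\quad I_5=I_1\times I_4,\quad I_2=\tfrac1{\kappa_2}\big(I_{1s}-\langle I_{1s},I_4\rangle I_4-\langle I_{1s},I_5\rangle I_5\big),$$ $$I_3=I_1\times I_2,\quad I_6=I_2\times I_4,\quad I_7=I_3\times I_4,$$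 where $\kappa_2=\sqrt{|I_{1s}|^2-\langle I_{1s},I_4\rangle^2-\langle I_{1s},I_5\rangle^2}$ (the frame is used only where $\kappa_2>0$). Put $\rho_1=\langle I_{1s},I_5\rangle$, $\rho_2=\langle I_{2s},I_6\rangle$, $\alpha=\langle I_{2s},I_3\rangle$, $\beta_1=\langle I_{2s},I_7\rangle$, $\beta_2=\langle I_{3s},I_6\rangle$, $$r=\tfrac1{\sqrt2}e^{-\sqrt{-1}\int_{s_0}^s\rho_1},\qquad q=\tfrac1{\sqrt2}e^{-\sqrt{-1}\int_{s_0}^s\rho_2},$$ $$\varphi_2=2\kappa_2 r\bar q,\qquad \varphi_3=-\sqrt2\,q^2r\,[\,2\alpha+\sqrt{-1}(\beta_1+\beta_2)\,].$$ Let $E_1=\gamma_s=I_4$, $E_2=\gamma_t/k_1\,(=-I_5)$, $E_3=I_1$, $E_4=I_2$, $E_5=I_6$, $E_6=I_3$, $E_7=I_7$, so that $E_1,E_2$ are tangent and $E_3,\dots,E_7$ are normal to $\Sigma$. For an orthonormal frame $F_1=E_1$, $F_2=E_2$, $F_3,\dots,F_7$ along $\Sigma$, the coefficients of the second fundamental form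 are $h^\alpha_{ij}=\langle dF_i(E_j),F_\alpha\rangle$ for $i,j\in\{1,2\}$ and $3\le\alpha\le7$, where $dF_i(E_1)=\partial_sF_i$ and $dF_i(E_2)=\frac1{k_1}\partial_tF_i$. Write $h^\alpha_{ij}$ for the coefficients in the frame $E$ and $\widetilde h^\alpha_{ij}$ for those in the rotated frame $$\widetilde E_4=\cos\theta\,E_4-\sin\theta\,E_7,\qquad \widetilde E_7=\sin\theta\,E_4+\cos\theta\,E_7,\qquad \widetilde E_a=E_a\ \ (a\ne4,7),$$ $$\theta=\arccos\frac{h^4_{22}}{\sqrt{(h^4_{22})^2+\frac94|\varphi_2|^2}}.$$ **Proposition.** Suppose that $\varphi_3=0$ and $\varphi_2\ne0$ everywhere on $J\times S$. Then $$\widetilde h^\alpha_{ij}=0\qquad\text{on } J\times S,\quad\text{for } \alpha\in\{6,7\},\ i,j\in\{1,2\}.$$ Moreover the normal bundle of $\Sigma$ is flat in the directions $\widetilde E_6$ and $\widetilde E_7$: the normal curvature satisfies $$R^\perp(\partial_t,\partial_s)\widetilde E_\alpha=\nabla^\perp_{\partial_t}\nabla^\perp_{\partial_s}\widetilde E_\alpha-\nabla^\perp_{\partial_s}\nabla^\perp_{\partial_t}\widetilde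 E_\alpha=0\qquad\text{on } J\times S,\quad\text{for }\alpha\in\{6,7\},$$ where $\nabla^\perp$ is the normal connection, i.e. differentiation in $\mathbb R^7$ followed by orthogonal projection to the normal space of $\Sigma$. -/

import Mathlib

open scoped ContDiff

noncomputable section

namespace G2Flow

/-! ### Octonions and the cross product on their imaginary part -/

/-- The octonions as pairs of quaternions: `(a, b)` stands for `a + b l`.
The multiplication is `octMul` below (and not the componentwise one of a product type). -/
abbrev Oct : Type := Quaternion ℝ × Quaternion ℝ

/-- Octonion multiplication. It is the bilinear extension of quaternion multiplication by
`a (b l) = (b a) l`, `(a l) b = (a b̄) l`, `(a l) (b l) = - b̄ a`. -/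
def octMul (x y : Oct) : Oct :=
  (x.1 * y.1 - star y.2 * x.2, y.2 * x.1 + x.2 * star y.1)

/-- Octonion conjugation. -/
def octConj (x : Oct) : Oct := (star x.1, -x.2)

/-- The cross product `x × y = (ȳ x - x̄ y) / 2` of octonions. -/
def octCross (x y : Oct) : Oct :=
  (2⁻¹ : ℝ) • (octMul (octConj y) x - octMul (octConj x) y)

/-- Euclidean space `ℝ⁷ = Im 𝕆`; coordinates refer to the orthonormal basis
`i, j, k, l, il, jl, kl`. -/
abbrev ImOct : Type := EuclideanSpace ℝ (Fin 7)

/-- The quaternion `a + b i + c j + d k`. -/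
def quat (a b c d : ℝ) : Quaternion ℝ := ⟨a, b, c, d⟩

@[simp] theorem quat_re (a b c d : ℝ) : (quat a b c d).re = a := rfl
@[simp] theorem quat_imI (a b c d : ℝ) : (quat a b c d).imI = b := rfl
@[simp] theorem quat_imJ (a b c d : ℝ) : (quat a b c d).imJ = c := rfl
@[simp] theorem quat_imK (a b c d : ℝ) : (quat a b c d).imK = d := rfl

/-- The inclusion `ℝ⁷ = Im 𝕆 → 𝕆`. -/
def toOct (x : ImOct) : Oct := (quat 0 (x 0) (x 1) (x 2), quat (x 3) (x 4) (x 5) (x 6))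

/-- The imaginary part `𝕆 → Im 𝕆 = ℝ⁷`. -/
def imOct (x : Oct) : ImOct :=
  !₂[x.1.imI, x.1.imJ, x.1.imK, x.2.re, x.2.imI, x.2.imJ, x.2.imK]

/-- The cross product of `ℝ⁷ = Im 𝕆`. -/
def cross (x y : ImOct) : ImOct := imOct (octCross (toOct x) (toOct y))

/-- The octonionic cross product of imaginary octonions is imaginary, so that `cross` is its
restriction. -/
theorem toOct_cross (x y : ImOct) : toOct (cross x y) = octCross (toOct x) (toOct y) := by
  apply Prod.ext <;> apply Quaternion.ext <;>
    simp [cross, imOct, octCross, toOct, octMul, octConj] <;> ring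

/-! ### The `G₂`-frame, the `G₂`-invariants and the functions `φ₁, φ₂, φ₃` of a curve in `ℝ⁷` -/

section Curve

variable (c : ℝ → ImOct) (s₀ : ℝ)

/-- `k₁ = ‖c_ss‖`. -/
def k1 (s : ℝ) : ℝ := ‖deriv (deriv c) s‖

/-- `I₄ = c_s`. -/
def I4 (s : ℝ) : ImOct := deriv c s

/-- `I₁ = I₄_s / k₁`. -/
def I1 (s : ℝ) : ImOct := (k1 c s)⁻¹ • deriv (I4 c) s

/-- `I₅ = I₁ × I₄`. -/
def I5 (s : ℝ) : ImOct := cross (I1 c s) (I4 c s)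

/-- `κ₂ = √(‖I₁_s‖² - ⟨I₁_s, I₄⟩² - ⟨I₁_s, I₅⟩²)`. -/
def kappa2 (s : ℝ) : ℝ :=
  Real.sqrt (‖deriv (I1 c) s‖ ^ 2 - inner ℝ (deriv (I1 c) s) (I4 c s) ^ 2
    - inner ℝ (deriv (I1 c) s) (I5 c s) ^ 2)

/-- `I₂ = (I₁_s - ⟨I₁_s, I₄⟩ I₄ - ⟨I₁_s, I₅⟩ I₅) / κ₂`. -/
def I2 (s : ℝ) : ImOct :=
  (kappa2 c s)⁻¹ • (deriv (I1 c) s - inner ℝ (deriv (I1 c) s) (I4 c s) • I4 c s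
    - inner ℝ (deriv (I1 c) s) (I5 c s) • I5 c s)

/-- `I₃ = I₁ × I₂`. -/
def I3 (s : ℝ) : ImOct := cross (I1 c s) (I2 c s)

/-- `I₆ = I₂ × I₄`. -/
def I6 (s : ℝ) : ImOct := cross (I2 c s) (I4 c s)

/-- `I₇ = I₃ × I₄`. -/
def I7 (s : ℝ) : ImOct := cross (I3 c s) (I4 c s)

/-- `ρ₁ = ⟨I₁_s, I₅⟩`. -/
def rho1 (s : ℝ) : ℝ := inner ℝ (deriv (I1 c) s) (I5 c s)

/-- `ρ₂ = ⟨I₂_s, I₆⟩`. -/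
def rho2 (s : ℝ) : ℝ := inner ℝ (deriv (I2 c) s) (I6 c s)

/-- `α = ⟨I₂_s, I₃⟩`. -/
def alpha (s : ℝ) : ℝ := inner ℝ (deriv (I2 c) s) (I3 c s)

/-- `β₁ = ⟨I₂_s, I₇⟩`. -/
def beta1 (s : ℝ) : ℝ := inner ℝ (deriv (I2 c) s) (I7 c s)

/-- `β₂ = ⟨I₃_s, I₆⟩`. -/
def beta2 (s : ℝ) : ℝ := inner ℝ (deriv (I3 c) s) (I6 c s)

/-- `r = exp (-√-1 ∫ ρ₁) / √2`, the integral running from the base point `s₀` to `s`. -/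
def rPhase (s : ℝ) : ℂ :=
  (1 / (Real.sqrt 2 : ℂ)) * Complex.exp (-Complex.I * ((∫ x in s₀..s, rho1 c x : ℝ) : ℂ))

/-- `q = exp (-√-1 ∫ ρ₂) / √2`, the integral running from the base point `s₀` to `s`. -/
def qPhase (s : ℝ) : ℂ :=
  (1 / (Real.sqrt 2 : ℂ)) * Complex.exp (-Complex.I * ((∫ x in s₀..s, rho2 c x : ℝ) : ℂ))

/-- `φ₂ = 2 κ₂ r q̄`. -/
def phi2 (s : ℝ) : ℂ :=
  2 * (kappa2 c s : ℂ) * rPhase c s₀ s * (starRingEnd ℂ) (qPhase c s₀ s)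

/-- `φ₃ = -√2 q² r (2 α + √-1 (β₁ + β₂))`. -/
def phi3 (s : ℝ) : ℂ :=
  -(Real.sqrt 2 : ℂ) * qPhase c s₀ s ^ 2 * rPhase c s₀ s
    * (2 * (alpha c s : ℂ) + Complex.I * ((beta1 c s + beta2 c s : ℝ) : ℂ))

end Curve

/-! ### The swept surface `(t, s) ↦ γ t s` -/

section Surface

/-- The partial derivative in `t`. -/
def partialT (X : ℝ → ℝ → ImOct) (t s : ℝ) : ImOct := deriv (fun τ => X τ s) t

/-- The partial derivative in `s`. -/
def partialS (X : ℝ → ℝ → ImOct) (t s : ℝ) : ImOct := deriv (fun σ => X t σ) s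

variable (γ : ℝ → ℝ → ImOct) (s₀ : ℝ)

/-- The orthonormal frame `E₁, …, E₇` along the surface, with labels `1, …, 7`
(the value at any other label is irrelevant). -/
def frameE : ℕ → ℝ → ℝ → ImOct
  | 1, t, s => partialS γ t s
  | 2, t, s => (k1 (γ t) s)⁻¹ • partialT γ t s
  | 3, t, s => I1 (γ t) s
  | 4, t, s => I2 (γ t) s
  | 5, t, s => I6 (γ t) s
  | 6, t, s => I3 (γ t) s
  | 7, t, s => I7 (γ t) s
  | _, _, _ => 0

/-- The derivative of a map `X` along the tangent vector `E_j` of the surface, `j = 1, 2`, where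
`E₁ = γ_s` and `E₂ = γ_t / k₁`; that is, `dX = (alongE 1 X) ω¹ + (alongE 2 X) ω²` for the
coframe `ω¹ = ds`, `ω² = k₁ dt` dual to `E₁, E₂`. -/
def alongE (j : ℕ) (X : ℝ → ℝ → ImOct) (t s : ℝ) : ImOct :=
  match j with
  | 1 => partialS X t s
  | 2 => (k1 (γ t) s)⁻¹ • partialT X t s
  | _ => 0

/-- The coefficients `h^α_{ij}` (`i, j ∈ {1, 2}`, `α ∈ {3, …, 7}`) of the second fundamental form
in a frame `F` with `F₁ = E₁` and `F₂ = E₂`: the `F_α`-component of `dF_i` is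
`h^α_{i1} ω¹ + h^α_{i2} ω²`. -/
def secondForm (F : ℕ → ℝ → ℝ → ImOct) (α i j : ℕ) (t s : ℝ) : ℝ :=
  inner ℝ (alongE γ j (F i) t s) (F α t s)

/-- `θ = arccos (h⁴₂₂ / √((h⁴₂₂)² + (9/4) |φ₂|²))`. -/
def theta (t s : ℝ) : ℝ :=
  Real.arccos (secondForm γ (frameE γ) 4 2 2 t s /
    Real.sqrt (secondForm γ (frameE γ) 4 2 2 t s ^ 2 + 9 / 4 * ‖phi2 (γ t) s₀ s‖ ^ 2))

/-- The frame `Ẽ₁, …, Ẽ₇`: it is `E₁, …, E₇` rotated by `θ` in the `(E₄, E₇)`-plane. -/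
def frameRot : ℕ → ℝ → ℝ → ImOct
  | 4, t, s => Real.cos (theta γ s₀ t s) • frameE γ 4 t s
      - Real.sin (theta γ s₀ t s) • frameE γ 7 t s
  | 7, t, s => Real.sin (theta γ s₀ t s) • frameE γ 4 t s
      + Real.cos (theta γ s₀ t s) • frameE γ 7 t s
  | a, t, s => frameE γ a t s

/-- The component of `v` normal to the surface at `γ t s`. -/
def normalPart (t s : ℝ) (v : ImOct) : ImOct :=
  v - inner ℝ v (frameE γ 1 t s) • frameE γ 1 t s - inner ℝ v (frameE γ 2 t s) • frameE γ 2 t s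

/-- The normal connection in the direction `∂/∂t`. -/
def normalDT (ξ : ℝ → ℝ → ImOct) (t s : ℝ) : ImOct := normalPart γ t s (partialT ξ t s)

/-- The normal connection in the direction `∂/∂s`. -/
def normalDS (ξ : ℝ → ℝ → ImOct) (t s : ℝ) : ImOct := normalPart γ t s (partialS ξ t s)

/-- The normal curvature `R^⊥(∂/∂t, ∂/∂s) ξ` of a normal field `ξ`. -/
def normalCurvature (ξ : ℝ → ℝ → ImOct) (t s : ℝ) : ImOct :=
  normalDT γ (normalDS γ ξ) t s - normalDS γ (normalDT γ ξ) t s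

end Surface

end G2Flow

end

/-! Call a normal field `X` null if it is orthogonal to all derivatives of the tangent frame `I₄`,
`-I₅`. Differentiating `⟨X, I₄⟩ = ⟨X, I₅⟩ = 0` shows that `X_t` and `X_s` are again normal, so the
normal connection acts on `X` as plain differentiation. The normal curvature of `X` is then the
difference of two mixed partials, which is zero (`IsNullNormal.normalCurvature_eq_zero`). Both
claims thus reduce to the nullity of `Ẽ₆` and `Ẽ₇`.

The derivatives `I₄_s`, `I₄_t`, `I₅_s` lie in the span of `I₁`, `I₅`, `I₆`. A field in the span of
`I₂`, `I₃`, `I₇` therefore only has to be orthogonal to `I₅_t`. The compatibility `I₄_st = I₄_ts`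
gives `⟨I₅_t, I₃⟩ = κ₂ α` and `⟨I₅_t, I₇⟩ = κ₂ (k₁ + β₂)` (`inner_I5_t_I3`, `inner_I5_t_I7`), while
`⟨I₅_t, I₂⟩ = -k₁ h⁴₂₂`.

The equation `φ₃ = 0` means `α = 0` and `β₁ + β₂ = 0`. The first makes `I₃` null. The second, with
the structural relation `β₂ = β₁ + k₁` (`beta2_eq`), forces `β₂ = k₁/2`, so the `(I₂, I₇)`-part of
`I₅_t` is `k₁ (-h⁴₂₂, (3/2) κ₂)`. As `|φ₂| = κ₂`, the angle `θ` is the one for which `(sin θ, cos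
θ)` is the unit vector along `((3/2) κ₂, h⁴₂₂)`, perpendicular to that part. -/

noncomputable section

namespace G2Flow

/-! ### Algebra of the cross product -/

/-- The cross product in coordinates. -/
theorem cross_eq (x y : ImOct) : cross x y =
    !₂[x 1 * y 2 - x 2 * y 1 + x 3 * y 4 - x 4 * y 3 + x 6 * y 5 - x 5 * y 6,
      x 2 * y 0 - x 0 * y 2 + x 3 * y 5 - x 5 * y 3 + x 4 * y 6 - x 6 * y 4,
      x 0 * y 1 - x 1 * y 0 + x 3 * y 6 - x 6 * y 3 + x 5 * y 4 - x 4 * y 5,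
      x 4 * y 0 - x 0 * y 4 + x 5 * y 1 - x 1 * y 5 + x 6 * y 2 - x 2 * y 6,
      x 0 * y 3 - x 3 * y 0 + x 2 * y 5 - x 5 * y 2 + x 6 * y 1 - x 1 * y 6,
      x 1 * y 3 - x 3 * y 1 + x 0 * y 6 - x 6 * y 0 + x 4 * y 2 - x 2 * y 4,
      x 2 * y 3 - x 3 * y 2 + x 1 * y 4 - x 4 * y 1 + x 5 * y 0 - x 0 * y 5] := by
  refine congrArg (WithLp.toLp 2) (funext fun i => ?_)
  fin_cases i <;> simp [octCross, toOct, octMul, octConj] <;> ring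

/-- The cross product as a bilinear map. -/
def crossLin : ImOct →ₗ[ℝ] ImOct →ₗ[ℝ] ImOct :=
  LinearMap.mk₂ ℝ cross
    (by intro x y z; ext i; fin_cases i <;> simp [cross_eq] <;> ring)
    (by intro a x y; ext i; fin_cases i <;> simp [cross_eq] <;> ring)
    (by intro x y z; ext i; fin_cases i <;> simp [cross_eq] <;> ring)
    (by intro a x y; ext i; fin_cases i <;> simp [cross_eq] <;> ring)

/-- The cross product as a continuous bilinear map. -/
def crossL : ImOct →L[ℝ] ImOct →L[ℝ] ImOct := crossLin.toContinuousBilinearMap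

theorem cross_add_left (x y z : ImOct) : cross (x + y) z = cross x z + cross y z :=
  crossLin.map_add₂ x y z

theorem cross_add_right (x y z : ImOct) : cross x (y + z) = cross x y + cross x z :=
  (crossLin x).map_add y z

theorem cross_smul_left (a : ℝ) (x y : ImOct) : cross (a • x) y = a • cross x y :=
  crossLin.map_smul₂ a x y

theorem cross_smul_right (a : ℝ) (x y : ImOct) : cross x (a • y) = a • cross x y :=
  (crossLin x).map_smul a y

theorem cross_anticomm (x y : ImOct) : cross x y = -cross y x := by
  ext i
  fin_cases i <;> simp [cross_eq] <;> ring

theorem inner_cross_left (x y z : ImOct) :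
    inner ℝ (cross x y) z = inner ℝ x (cross y z) := by
  simp [PiLp.inner_apply, Fin.sum_univ_seven, cross_eq]
  ring

/-- The polarised identity `x × (x × z) = ⟨x, z⟩ x - |x|² z`. -/
theorem cross_cross_add (x y z : ImOct) :
    cross x (cross y z) + cross y (cross x z) =
      inner ℝ x z • y + inner ℝ y z • x - (2 * inner ℝ x y) • z := by
  ext i
  fin_cases i <;>
    simp [PiLp.inner_apply, Fin.sum_univ_seven, cross_eq] <;> ring

theorem cross_self (x : ImOct) : cross x x = 0 := by
  ext i
  fin_cases i <;> simp [cross_eq] <;> ring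

theorem cross_neg_right (x y : ImOct) : cross x (-y) = -cross x y :=
  (crossLin x).map_neg y

theorem cross_cross_self (x z : ImOct) :
    cross x (cross x z) = inner ℝ x z • x - inner ℝ x x • z := by
  have h := cross_cross_add x x z
  have h2 : (2 : ℝ) • cross x (cross x z) = (2 : ℝ) • (inner ℝ x z • x - inner ℝ x x • z) := by
    rw [two_smul, h]; module
  exact smul_right_injective _ (two_ne_zero) h2

theorem inner_cross_self_left (x y : ImOct) : inner ℝ (cross x y) x = 0 := by
  rw [cross_anticomm, inner_neg_left, inner_cross_left, cross_self, inner_zero_right, neg_zero]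

theorem inner_cross_self_right (x y : ImOct) : inner ℝ (cross x y) y = 0 := by
  rw [inner_cross_left, cross_self, inner_zero_right]

/-- Three vectors of `ℝ⁷` that generate a `G₂`-frame. -/
structure IsG2Triple (a b c : ImOct) : Prop where
  aa : inner ℝ a a = (1 : ℝ)
  bb : inner ℝ b b = (1 : ℝ)
  cc : inner ℝ c c = (1 : ℝ)
  ab : inner ℝ a b = (0 : ℝ)
  ac : inner ℝ a c = (0 : ℝ)
  bc : inner ℝ b c = (0 : ℝ)
  b_ac : inner ℝ b (cross a c) = (0 : ℝ)

/-! ### Products and inner products within the frame generated by a triple. -/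

namespace IsG2Triple

variable {a b c : ImOct}

theorem cross_a_ac (h : IsG2Triple a b c) : cross a (cross a c) = -c := by
  rw [cross_cross_self, h.ac, h.aa, zero_smul, one_smul, zero_sub]

theorem cross_b_bc (h : IsG2Triple a b c) : cross b (cross b c) = -c := by
  rw [cross_cross_self, h.bc, h.bb, zero_smul, one_smul, zero_sub]

theorem cross_ac_c (h : IsG2Triple a b c) : cross (cross a c) c = -a := by
  rw [cross_anticomm (cross a c), cross_anticomm a, cross_neg_right, neg_neg,
    cross_cross_self, real_inner_comm, h.ac, h.cc]
  simp

theorem cross_bc_c (h : IsG2Triple a b c) : cross (cross b c) c = -b := by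
  rw [cross_anticomm (cross b c), cross_anticomm b, cross_neg_right, neg_neg,
    cross_cross_self, real_inner_comm, h.bc, h.cc]
  simp

theorem inner_ab_c (h : IsG2Triple a b c) : inner ℝ (cross a b) c = (0 : ℝ) := by
  rw [inner_cross_left, cross_anticomm, inner_neg_right, ← inner_cross_left, real_inner_comm,
    h.b_ac, neg_zero]

theorem inner_ab_ac (h : IsG2Triple a b c) : inner ℝ (cross a b) (cross a c) = (0 : ℝ) := by
  rw [cross_anticomm a b, inner_neg_left, inner_cross_left, h.cross_a_ac, inner_neg_right, h.bc]
  simp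

theorem inner_ab_bc (h : IsG2Triple a b c) : inner ℝ (cross a b) (cross b c) = (0 : ℝ) := by
  rw [inner_cross_left, h.cross_b_bc, inner_neg_right, h.ac, neg_zero]

theorem inner_abc_a (h : IsG2Triple a b c) :
    inner ℝ (cross (cross a b) c) a = (0 : ℝ) := by
  rw [inner_cross_left, cross_anticomm c, inner_neg_right, h.inner_ab_ac, neg_zero]

theorem inner_abc_b (h : IsG2Triple a b c) :
    inner ℝ (cross (cross a b) c) b = (0 : ℝ) := by
  rw [inner_cross_left, cross_anticomm c, inner_neg_right, h.inner_ab_bc, neg_zero]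

theorem inner_abc_ac (h : IsG2Triple a b c) :
    inner ℝ (cross (cross a b) c) (cross a c) = (0 : ℝ) := by
  rw [inner_cross_left, cross_anticomm c, h.cross_ac_c, neg_neg, inner_cross_self_left]

theorem inner_abc_bc (h : IsG2Triple a b c) :
    inner ℝ (cross (cross a b) c) (cross b c) = (0 : ℝ) := by
  rw [inner_cross_left, cross_anticomm c, h.cross_bc_c, neg_neg, inner_cross_self_right]

/-- The right side of `cross_cross_add a c b` vanishes by orthogonality. This anti-associativity is
what identifies `I₁ × I₆` with `-I₇`. -/
theorem cross_a_bc (h : IsG2Triple a b c) : cross a (cross b c) = -cross (cross a b) c := by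
  have h1 := cross_cross_add a c b
  rw [h.ab, real_inner_comm, h.bc, h.ac, cross_anticomm c b, cross_anticomm c (cross a b),
    cross_neg_right] at h1
  have h2 : -cross a (cross b c) + -cross (cross a b) c = 0 := by simpa using h1
  rw [neg_add_eq_zero] at h2
  exact h2

theorem cross_c_abc (h : IsG2Triple a b c) : cross c (cross (cross a b) c) = cross a b := by
  rw [cross_anticomm _ c, cross_neg_right, cross_cross_self, real_inner_comm, h.inner_ab_c, h.cc]
  simp

theorem inner_ab_ab (h : IsG2Triple a b c) : inner ℝ (cross a b) (cross a b) = (1 : ℝ) := by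
  nth_rw 1 [cross_anticomm a b]
  rw [inner_neg_left, inner_cross_left, cross_cross_self, h.ab, h.aa, zero_smul, one_smul,
    zero_sub, inner_neg_right, neg_neg, h.bb]

theorem inner_abc_abc (h : IsG2Triple a b c) :
    inner ℝ (cross (cross a b) c) (cross (cross a b) c) = (1 : ℝ) := by
  rw [inner_cross_left, h.cross_c_abc, h.inner_ab_ab]

end IsG2Triple

/-! ### Calculus of maps of two real variables on a product of open sets -/

section Calculus

variable {F : Type*} [NormedAddCommGroup F] [NormedSpace ℝ F] {J S : Set ℝ}

/-- `X` is smooth on `J × S`. -/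
def SmoothRect (J S : Set ℝ) (X : ℝ → ℝ → F) : Prop :=
  ContDiffOn ℝ ∞ (Function.uncurry X) (J ×ˢ S)

theorem SmoothRect.congr {X Y : ℝ → ℝ → F} (hX : SmoothRect J S X)
    (h : ∀ t ∈ J, ∀ s ∈ S, Y t s = X t s) : SmoothRect J S Y :=
  ContDiffOn.congr hX fun p hp => h p.1 hp.1 p.2 hp.2

theorem SmoothRect.smul {a : ℝ → ℝ → ℝ} {X : ℝ → ℝ → F} (ha : SmoothRect J S a)
    (hX : SmoothRect J S X) : SmoothRect J S fun t s => a t s • X t s :=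
  ContDiffOn.smul ha hX

theorem SmoothRect.add {X Y : ℝ → ℝ → F} (hX : SmoothRect J S X)
    (hY : SmoothRect J S Y) : SmoothRect J S fun t s => X t s + Y t s :=
  ContDiffOn.add hX hY

theorem SmoothRect.sub {X Y : ℝ → ℝ → F} (hX : SmoothRect J S X)
    (hY : SmoothRect J S Y) : SmoothRect J S fun t s => X t s - Y t s :=
  ContDiffOn.sub hX hY

theorem SmoothRect.const_mul {a : ℝ → ℝ → ℝ} (ha : SmoothRect J S a) (r : ℝ) :
    SmoothRect J S fun t s => r * a t s :=
  ContDiffOn.mul contDiffOn_const ha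

theorem SmoothRect.pow {a : ℝ → ℝ → ℝ} (ha : SmoothRect J S a) (n : ℕ) :
    SmoothRect J S fun t s => a t s ^ n :=
  ContDiffOn.pow ha n

theorem SmoothRect.inv {a : ℝ → ℝ → ℝ} (ha : SmoothRect J S a)
    (h : ∀ t ∈ J, ∀ s ∈ S, a t s ≠ 0) : SmoothRect J S fun t s => (a t s)⁻¹ :=
  ContDiffOn.inv ha fun p hp => h p.1 hp.1 p.2 hp.2

theorem SmoothRect.div {a b : ℝ → ℝ → ℝ} (ha : SmoothRect J S a) (hb : SmoothRect J S b)
    (h : ∀ t ∈ J, ∀ s ∈ S, b t s ≠ 0) : SmoothRect J S fun t s => a t s / b t s :=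
  ContDiffOn.div ha hb fun p hp => h p.1 hp.1 p.2 hp.2

theorem SmoothRect.sqrt {a : ℝ → ℝ → ℝ} (ha : SmoothRect J S a)
    (h : ∀ t ∈ J, ∀ s ∈ S, a t s ≠ 0) : SmoothRect J S fun t s => Real.sqrt (a t s) :=
  ContDiffOn.sqrt ha fun p hp => h p.1 hp.1 p.2 hp.2

theorem SmoothRect.norm {X : ℝ → ℝ → ImOct} (hX : SmoothRect J S X)
    (h : ∀ t ∈ J, ∀ s ∈ S, X t s ≠ 0) : SmoothRect J S fun t s => ‖X t s‖ :=
  ContDiffOn.norm ℝ hX fun p hp => h p.1 hp.1 p.2 hp.2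

theorem SmoothRect.inner {X Y : ℝ → ℝ → ImOct} (hX : SmoothRect J S X)
    (hY : SmoothRect J S Y) : SmoothRect J S fun t s => inner ℝ (X t s) (Y t s) :=
  ContDiffOn.inner ℝ hX hY

theorem SmoothRect.cross {X Y : ℝ → ℝ → ImOct} (hX : SmoothRect J S X)
    (hY : SmoothRect J S Y) : SmoothRect J S fun t s => cross (X t s) (Y t s) :=
  ContDiffOn.clm_apply (crossL.contDiff.comp_contDiffOn hX) hY

theorem hasDerivAt_comp_prodMk_left {G : ℝ × ℝ → F} {t s : ℝ} (hG : DifferentiableAt ℝ G (t, s)) :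
    HasDerivAt (fun τ => G (τ, s)) (fderiv ℝ G (t, s) (1, 0)) t :=
  HasFDerivAt.comp_hasDerivAt (f := fun τ => (τ, s)) t hG.hasFDerivAt
    ((hasDerivAt_id' t).prodMk (hasDerivAt_const t s))

theorem hasDerivAt_comp_prodMk_right {G : ℝ × ℝ → F} {t s : ℝ} (hG : DifferentiableAt ℝ G (t, s)) :
    HasDerivAt (fun σ => G (t, σ)) (fderiv ℝ G (t, s) (0, 1)) s :=
  HasFDerivAt.comp_hasDerivAt (f := fun σ => (t, σ)) s hG.hasFDerivAt
    ((hasDerivAt_const s t).prodMk (hasDerivAt_id' s))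

theorem SmoothRect.differentiableAt {X : ℝ → ℝ → F} (hX : SmoothRect J S X) (hJ : IsOpen J)
    (hS : IsOpen S) {t s : ℝ} (ht : t ∈ J) (hs : s ∈ S) :
    DifferentiableAt ℝ (Function.uncurry X) (t, s) :=
  (ContDiffOn.contDiffAt hX ((hJ.prod hS).mem_nhds ⟨ht, hs⟩)).differentiableAt (by simp)

theorem SmoothRect.hasDerivAt_fderiv_left {X : ℝ → ℝ → F} (hX : SmoothRect J S X)
    (hJ : IsOpen J) (hS : IsOpen S) {t s : ℝ} (ht : t ∈ J) (hs : s ∈ S) :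
    HasDerivAt (fun τ => X τ s) (fderiv ℝ (Function.uncurry X) (t, s) (1, 0)) t :=
  hasDerivAt_comp_prodMk_left (hX.differentiableAt hJ hS ht hs)

theorem SmoothRect.hasDerivAt_fderiv_right {X : ℝ → ℝ → F} (hX : SmoothRect J S X)
    (hJ : IsOpen J) (hS : IsOpen S) {t s : ℝ} (ht : t ∈ J) (hs : s ∈ S) :
    HasDerivAt (fun σ => X t σ) (fderiv ℝ (Function.uncurry X) (t, s) (0, 1)) s :=
  hasDerivAt_comp_prodMk_right (hX.differentiableAt hJ hS ht hs)

theorem SmoothRect.hasDerivAt_left {X : ℝ → ℝ → F} (hX : SmoothRect J S X)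
    (hJ : IsOpen J) (hS : IsOpen S) {t s : ℝ} (ht : t ∈ J) (hs : s ∈ S) :
    HasDerivAt (fun τ => X τ s) (deriv (fun τ => X τ s) t) t :=
  (hX.hasDerivAt_fderiv_left hJ hS ht hs).differentiableAt.hasDerivAt

theorem SmoothRect.hasDerivAt_right {X : ℝ → ℝ → F} (hX : SmoothRect J S X)
    (hJ : IsOpen J) (hS : IsOpen S) {t s : ℝ} (ht : t ∈ J) (hs : s ∈ S) :
    HasDerivAt (fun σ => X t σ) (deriv (fun σ => X t σ) s) s :=
  (hX.hasDerivAt_fderiv_right hJ hS ht hs).differentiableAt.hasDerivAt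

theorem SmoothRect.fderiv_apply {X : ℝ → ℝ → F} (hX : SmoothRect J S X)
    (hJ : IsOpen J) (hS : IsOpen S) (v : ℝ × ℝ) :
    SmoothRect J S fun t s => fderiv ℝ (Function.uncurry X) (t, s) v :=
  (ContDiffOn.fderiv_of_isOpen (m := ∞) hX (hJ.prod hS) (by simp)).clm_apply contDiffOn_const

theorem SmoothRect.deriv_left {X : ℝ → ℝ → F} (hX : SmoothRect J S X)
    (hJ : IsOpen J) (hS : IsOpen S) : SmoothRect J S fun t s => deriv (fun τ => X τ s) t :=
  (hX.fderiv_apply hJ hS (1, 0)).congr fun _ ht _ hs =>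
    (hX.hasDerivAt_fderiv_left hJ hS ht hs).deriv

theorem SmoothRect.deriv_right {X : ℝ → ℝ → F} (hX : SmoothRect J S X)
    (hJ : IsOpen J) (hS : IsOpen S) : SmoothRect J S fun t s => deriv (fun σ => X t σ) s :=
  (hX.fderiv_apply hJ hS (0, 1)).congr fun _ ht _ hs =>
    (hX.hasDerivAt_fderiv_right hJ hS ht hs).deriv

/-- All identities hold only on `J × S`; openness is what allows them to be differentiated. -/
theorem deriv_congr_on {f g : ℝ → F} {U : Set ℝ} (hU : IsOpen U)
    (h : ∀ x ∈ U, f x = g x) {x : ℝ} (hx : x ∈ U) : deriv f x = deriv g x :=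
  Filter.EventuallyEq.deriv_eq (Filter.eventuallyEq_of_mem (hU.mem_nhds hx) h)

/-- Mixed partial derivatives commute. -/
theorem SmoothRect.deriv_deriv_comm {X : ℝ → ℝ → F} (hX : SmoothRect J S X)
    (hJ : IsOpen J) (hS : IsOpen S) {t s : ℝ} (ht : t ∈ J) (hs : s ∈ S) :
    deriv (fun τ => deriv (fun σ => X τ σ) s) t =
      deriv (fun σ => deriv (fun τ => X τ σ) t) s := by
  -- Both iterated partials become values of the second Fréchet derivative on `(1, 0)` and `(0, 1)`,
  -- in the two orders.
  rw [deriv_congr_on hJ (fun τ hτ => (hX.hasDerivAt_fderiv_right hJ hS hτ hs).deriv) ht,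
    deriv_congr_on hS (fun σ hσ => (hX.hasDerivAt_fderiv_left hJ hS ht hσ).deriv) hs]
  have hd : DifferentiableAt ℝ (fderiv ℝ (Function.uncurry X)) (t, s) :=
    ((ContDiffOn.fderiv_of_isOpen (m := ∞) hX (hJ.prod hS) (by simp)).contDiffAt
      ((hJ.prod hS).mem_nhds ⟨ht, hs⟩)).differentiableAt (by simp)
  have h1 := (hasDerivAt_comp_prodMk_left hd).clm_apply (hasDerivAt_const t ((0, 1) : ℝ × ℝ))
  have h2 := (hasDerivAt_comp_prodMk_right hd).clm_apply (hasDerivAt_const s ((1, 0) : ℝ × ℝ))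
  have h2top : minSmoothness ℝ 2 ≤ ∞ := by
    rw [minSmoothness_of_isRCLikeNormedField]
    exact WithTop.coe_le_coe.mpr (le_top : (2 : ℕ∞) ≤ ⊤)
  have hsymm := (ContDiffOn.contDiffAt hX
    ((hJ.prod hS).mem_nhds (show (t, s) ∈ J ×ˢ S from ⟨ht, hs⟩))).isSymmSndFDerivAt h2top
  rw [h1.deriv, h2.deriv, map_zero, add_zero, add_zero]
  exact hsymm (1, 0) (0, 1)

end Calculus

theorem HasDerivAt.cross {X Y : ℝ → ImOct} {X' Y' : ImOct} {x : ℝ}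
    (hX : HasDerivAt X X' x) (hY : HasDerivAt Y Y' x) :
    HasDerivAt (fun y => cross (X y) (Y y)) (cross (X x) Y' + cross X' (Y x)) x :=
  crossL.hasDerivAt_of_bilinear (fun _ => hX) (fun _ => hY)

/-- Differentiation of an identity `⟨X, Y⟩ = const`. -/
theorem inner_deriv_eq_neg {X Y : ℝ → ImOct} {U : Set ℝ} (hU : IsOpen U) {x : ℝ} (hx : x ∈ U)
    {X' Y' : ImOct} (hX : HasDerivAt X X' x) (hY : HasDerivAt Y Y' x) {a : ℝ}
    (h : ∀ y ∈ U, inner ℝ (X y) (Y y) = a) :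
    inner ℝ X' (Y x) = -inner ℝ (X x) Y' := by
  have h1 := (hX.inner ℝ hY).deriv
  rw [deriv_congr_on hU h hx, deriv_const] at h1
  linarith

/-! ### The `G₂`-frame along a solution of the binormal flow -/

/-- A solution of `γ_t = γ_s × γ_ss` on `J × S`, in arc length parametrisation and with
non-vanishing `k₁` and `κ₂`. -/
structure IsBinormalFlow (J S : Set ℝ) (γ : ℝ → ℝ → ImOct) : Prop where
  isOpen_left : IsOpen J
  isOpen_right : IsOpen S
  smooth : SmoothRect J S γ
  unit : ∀ t ∈ J, ∀ s ∈ S, ‖deriv (γ t) s‖ = 1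
  k1_pos : ∀ t ∈ J, ∀ s ∈ S, 0 < k1 (γ t) s
  flow : ∀ t ∈ J, ∀ s ∈ S,
    deriv (fun τ => γ τ s) t = cross (deriv (γ t) s) (deriv (deriv (γ t)) s)
  kappa2_ne : ∀ t ∈ J, ∀ s ∈ S, kappa2 (γ t) s ≠ 0

namespace IsBinormalFlow

variable {J S : Set ℝ} {γ : ℝ → ℝ → ImOct} {t s : ℝ}

/-! ### Smoothness and orthonormality of the frame. -/

theorem smooth_I4 (h : IsBinormalFlow J S γ) : SmoothRect J S fun t s => I4 (γ t) s :=
  h.smooth.deriv_right h.isOpen_left h.isOpen_right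

theorem smooth_I4_s (h : IsBinormalFlow J S γ) :
    SmoothRect J S fun t s => deriv (I4 (γ t)) s :=
  h.smooth_I4.deriv_right h.isOpen_left h.isOpen_right

theorem k1_ne (h : IsBinormalFlow J S γ) : ∀ t ∈ J, ∀ s ∈ S, k1 (γ t) s ≠ 0 :=
  fun t ht s hs => (h.k1_pos t ht s hs).ne'

theorem smooth_k1 (h : IsBinormalFlow J S γ) : SmoothRect J S fun t s => k1 (γ t) s :=
  h.smooth_I4_s.norm fun t ht s hs => norm_ne_zero_iff.mp (h.k1_ne t ht s hs)

theorem smooth_I1 (h : IsBinormalFlow J S γ) : SmoothRect J S fun t s => I1 (γ t) s :=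
  (h.smooth_k1.inv h.k1_ne).smul h.smooth_I4_s

theorem smooth_I5 (h : IsBinormalFlow J S γ) : SmoothRect J S fun t s => I5 (γ t) s :=
  h.smooth_I1.cross h.smooth_I4

theorem smooth_I1_s (h : IsBinormalFlow J S γ) :
    SmoothRect J S fun t s => deriv (I1 (γ t)) s :=
  h.smooth_I1.deriv_right h.isOpen_left h.isOpen_right

theorem smooth_rho1 (h : IsBinormalFlow J S γ) : SmoothRect J S fun t s => rho1 (γ t) s :=
  h.smooth_I1_s.inner h.smooth_I5

theorem smooth_kappa2 (h : IsBinormalFlow J S γ) : SmoothRect J S fun t s => kappa2 (γ t) s := by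
  refine SmoothRect.sqrt ((((h.smooth_I1_s.inner h.smooth_I1_s).congr fun t _ s _ => ?_).sub
    ((h.smooth_I1_s.inner h.smooth_I4).pow 2)).sub ((h.smooth_I1_s.inner h.smooth_I5).pow 2))
    fun t ht s hs h0 => h.kappa2_ne t ht s hs ?_
  · exact (real_inner_self_eq_norm_sq _).symm
  · rw [kappa2, h0, Real.sqrt_zero]

theorem smooth_I2 (h : IsBinormalFlow J S γ) : SmoothRect J S fun t s => I2 (γ t) s :=
  (h.smooth_kappa2.inv h.kappa2_ne).smul
    ((h.smooth_I1_s.sub ((h.smooth_I1_s.inner h.smooth_I4).smul h.smooth_I4)).sub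
      ((h.smooth_I1_s.inner h.smooth_I5).smul h.smooth_I5))

theorem smooth_I3 (h : IsBinormalFlow J S γ) : SmoothRect J S fun t s => I3 (γ t) s :=
  h.smooth_I1.cross h.smooth_I2

theorem smooth_I6 (h : IsBinormalFlow J S γ) : SmoothRect J S fun t s => I6 (γ t) s :=
  h.smooth_I2.cross h.smooth_I4

theorem smooth_I7 (h : IsBinormalFlow J S γ) : SmoothRect J S fun t s => I7 (γ t) s :=
  h.smooth_I3.cross h.smooth_I4

theorem inner_I4_I4 (h : IsBinormalFlow J S γ) (ht : t ∈ J) (hs : s ∈ S) :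
    inner ℝ (I4 (γ t) s) (I4 (γ t) s) = 1 := by
  rw [real_inner_self_eq_norm_sq, I4, h.unit t ht s hs, one_pow]

theorem hasDerivAt_I4 (h : IsBinormalFlow J S γ) (ht : t ∈ J) (hs : s ∈ S) :
    HasDerivAt (I4 (γ t)) (k1 (γ t) s • I1 (γ t) s) s := by
  rw [I1, smul_inv_smul₀ (h.k1_ne t ht s hs)]
  exact h.smooth_I4.hasDerivAt_right h.isOpen_left h.isOpen_right ht hs

theorem inner_I1_I1 (h : IsBinormalFlow J S γ) (ht : t ∈ J) (hs : s ∈ S) :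
    inner ℝ (I1 (γ t) s) (I1 (γ t) s) = 1 := by
  have hk := h.k1_ne t ht s hs
  have h1 : ‖deriv (I4 (γ t)) s‖ = k1 (γ t) s := rfl
  rw [I1, real_inner_smul_left, real_inner_smul_right, real_inner_self_eq_norm_sq, h1]
  field_simp

theorem inner_I1_I4 (h : IsBinormalFlow J S γ) (ht : t ∈ J) (hs : s ∈ S) :
    inner ℝ (I1 (γ t) s) (I4 (γ t) s) = 0 := by
  have h1 := inner_deriv_eq_neg h.isOpen_right hs (h.hasDerivAt_I4 ht hs)
    (h.hasDerivAt_I4 ht hs) (fun σ hσ => h.inner_I4_I4 ht hσ)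
  rw [real_inner_comm, self_eq_neg, real_inner_smul_right, real_inner_comm] at h1
  exact (mul_eq_zero.mp h1).resolve_left (h.k1_ne t ht s hs)

theorem hasDerivAt_I1' (h : IsBinormalFlow J S γ) (ht : t ∈ J) (hs : s ∈ S) :
    HasDerivAt (I1 (γ t)) (deriv (I1 (γ t)) s) s :=
  h.smooth_I1.hasDerivAt_right h.isOpen_left h.isOpen_right ht hs

theorem inner_I1_s_I1 (h : IsBinormalFlow J S γ) (ht : t ∈ J) (hs : s ∈ S) :
    inner ℝ (deriv (I1 (γ t)) s) (I1 (γ t) s) = 0 := by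
  have h1 := inner_deriv_eq_neg h.isOpen_right hs (h.hasDerivAt_I1' ht hs)
    (h.hasDerivAt_I1' ht hs) (fun σ hσ => h.inner_I1_I1 ht hσ)
  rwa [real_inner_comm, self_eq_neg, real_inner_comm] at h1

theorem inner_I1_s_I4 (h : IsBinormalFlow J S γ) (ht : t ∈ J) (hs : s ∈ S) :
    inner ℝ (deriv (I1 (γ t)) s) (I4 (γ t) s) = -k1 (γ t) s := by
  rw [inner_deriv_eq_neg h.isOpen_right hs (h.hasDerivAt_I1' ht hs)
    (h.hasDerivAt_I4 ht hs) (fun σ hσ => h.inner_I1_I4 ht hσ), real_inner_smul_right,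
    h.inner_I1_I1 ht hs, mul_one]

theorem inner_I5_I5 (h : IsBinormalFlow J S γ) (ht : t ∈ J) (hs : s ∈ S) :
    inner ℝ (I5 (γ t) s) (I5 (γ t) s) = 1 := by
  nth_rw 1 [I5]
  rw [I5, inner_cross_left, cross_anticomm (I1 (γ t) s), cross_neg_right, cross_cross_self,
    real_inner_comm (I1 (γ t) s) (I4 (γ t) s), h.inner_I1_I4 ht hs, h.inner_I4_I4 ht hs,
    zero_smul, one_smul, zero_sub, neg_neg, h.inner_I1_I1 ht hs]

theorem I1_s_eq (h : IsBinormalFlow J S γ) (ht : t ∈ J) (hs : s ∈ S) :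
    deriv (I1 (γ t)) s = -k1 (γ t) s • I4 (γ t) s + rho1 (γ t) s • I5 (γ t) s
      + kappa2 (γ t) s • I2 (γ t) s := by
  rw [I2, smul_inv_smul₀ (h.kappa2_ne t ht s hs), h.inner_I1_s_I4 ht hs, rho1]
  abel

/-- `I₂` is the normalised Gram–Schmidt remainder of `I₁_s`, which is already orthogonal to `I₁`.
With `(a, b, c) = (I₁, I₂, I₄)` the remaining vectors are `a × b = I₃`, `a × c = I₅`, `b × c = I₆`,
`(a × b) × c = I₇`. -/
theorem isG2Triple (h : IsBinormalFlow J S γ) (ht : t ∈ J) (hs : s ∈ S) :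
    IsG2Triple (I1 (γ t) s) (I2 (γ t) s) (I4 (γ t) s) := by
  have hκ := h.kappa2_ne t ht s hs
  have e41 : inner ℝ (I4 (γ t) s) (I1 (γ t) s) = 0 :=
    (real_inner_comm _ _).trans (h.inner_I1_I4 ht hs)
  have e51 : inner ℝ (I5 (γ t) s) (I1 (γ t) s) = 0 := inner_cross_self_left _ _
  have e54 : inner ℝ (I5 (γ t) s) (I4 (γ t) s) = 0 := inner_cross_self_right _ _
  have e45 : inner ℝ (I4 (γ t) s) (I5 (γ t) s) = 0 := (real_inner_comm _ _).trans e54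
  have i21 : inner ℝ (I2 (γ t) s) (I1 (γ t) s) = 0 := by
    simp only [I2, real_inner_smul_left, inner_sub_left, e41, e51, h.inner_I1_s_I1 ht hs]
    ring
  have i24 : inner ℝ (I2 (γ t) s) (I4 (γ t) s) = 0 := by
    simp only [I2, real_inner_smul_left, inner_sub_left, h.inner_I4_I4 ht hs, e54]
    ring
  have i25 : inner ℝ (I2 (γ t) s) (I5 (γ t) s) = 0 := by
    simp only [I2, real_inner_smul_left, inner_sub_left, h.inner_I5_I5 ht hs, e45]
    ring
  -- `Real.sqrt` is zero on negative numbers, so `κ₂ ≠ 0` excludes a negative radicand.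
  have hpos : 0 ≤ ‖deriv (I1 (γ t)) s‖ ^ 2 - inner ℝ (deriv (I1 (γ t)) s) (I4 (γ t) s) ^ 2
      - inner ℝ (deriv (I1 (γ t)) s) (I5 (γ t) s) ^ 2 := by
    by_contra hneg
    exact hκ (Real.sqrt_eq_zero_of_nonpos (not_le.mp hneg).le)
  have hsq := Real.sq_sqrt hpos
  rw [← kappa2] at hsq
  have i22 : inner ℝ (I2 (γ t) s) (I2 (γ t) s) = 1 := by
    -- Only one factor is expanded: its `I₄` and `I₅` terms drop out against `I₂`, leaving `⟨I₂,
    -- I₁_s⟩ / κ₂`.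
    nth_rw 2 [I2]
    rw [real_inner_smul_right, inner_sub_right, inner_sub_right, real_inner_smul_right,
      real_inner_smul_right, i24, i25]
    simp only [I2, real_inner_smul_left, inner_sub_left, real_inner_self_eq_norm_sq,
      real_inner_comm (deriv (I1 (γ t)) s) (I4 (γ t) s),
      real_inner_comm (deriv (I1 (γ t)) s) (I5 (γ t) s)]
    have : (kappa2 (γ t) s)⁻¹ * ((kappa2 (γ t) s)⁻¹ * kappa2 (γ t) s ^ 2) = 1 := by
      field_simp
    rw [hsq] at this
    linear_combination this
  exact ⟨h.inner_I1_I1 ht hs, i22, h.inner_I4_I4 ht hs, (real_inner_comm _ _).trans i21,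
    h.inner_I1_I4 ht hs, i24, i25⟩

/-! ### Structure equations in the arc length direction. -/

theorem hasDerivAt_I1 (h : IsBinormalFlow J S γ) (ht : t ∈ J) (hs : s ∈ S) :
    HasDerivAt (I1 (γ t)) (-k1 (γ t) s • I4 (γ t) s + rho1 (γ t) s • I5 (γ t) s
      + kappa2 (γ t) s • I2 (γ t) s) s := by
  rw [← h.I1_s_eq ht hs]
  exact h.hasDerivAt_I1' ht hs

theorem hasDerivAt_I5 (h : IsBinormalFlow J S γ) (ht : t ∈ J) (hs : s ∈ S) :
    HasDerivAt (I5 (γ t))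
      (-rho1 (γ t) s • I1 (γ t) s + kappa2 (γ t) s • I6 (γ t) s) s := by
  refine (HasDerivAt.cross (h.hasDerivAt_I1 ht hs) (h.hasDerivAt_I4 ht hs)).congr_deriv ?_
  rw [cross_smul_right, cross_self, cross_add_left, cross_add_left, cross_smul_left,
    cross_smul_left, cross_smul_left, cross_self, I5, (h.isG2Triple ht hs).cross_ac_c, I6]
  module

theorem hasDerivAt_I2 (h : IsBinormalFlow J S γ) (ht : t ∈ J) (hs : s ∈ S) :
    HasDerivAt (I2 (γ t)) (deriv (I2 (γ t)) s) s :=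
  h.smooth_I2.hasDerivAt_right h.isOpen_left h.isOpen_right ht hs

theorem hasDerivAt_I3 (h : IsBinormalFlow J S γ) (ht : t ∈ J) (hs : s ∈ S) :
    HasDerivAt (I3 (γ t)) (deriv (I3 (γ t)) s) s :=
  h.smooth_I3.hasDerivAt_right h.isOpen_left h.isOpen_right ht hs

theorem hasDerivAt_I6 (h : IsBinormalFlow J S γ) (ht : t ∈ J) (hs : s ∈ S) :
    HasDerivAt (I6 (γ t)) (deriv (I6 (γ t)) s) s :=
  h.smooth_I6.hasDerivAt_right h.isOpen_left h.isOpen_right ht hs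

/-- The relation `β₂ = β₁ + k₁` between the `G₂`-invariants. -/
theorem beta2_eq (h : IsBinormalFlow J S γ) (ht : t ∈ J) (hs : s ∈ S) :
    beta2 (γ t) s = beta1 (γ t) s + k1 (γ t) s := by
  have g := h.isG2Triple ht hs
  have h3 : deriv (I3 (γ t)) s = _ :=
    (HasDerivAt.cross (h.hasDerivAt_I1' ht hs) (h.hasDerivAt_I2 ht hs)).deriv
  have h61 : cross (I6 (γ t) s) (I1 (γ t) s) = I7 (γ t) s := by
    rw [cross_anticomm, I6, g.cross_a_bc, neg_neg]
    rfl
  have h26 : cross (I2 (γ t) s) (I6 (γ t) s) = -I4 (γ t) s := g.cross_b_bc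
  -- In `⟨I₁_s × I₂ + I₁ × I₂_s, I₆⟩` the first term is `⟨I₁_s, I₂ × I₆⟩ = -⟨I₁_s, I₄⟩ = k₁`, the
  -- second `⟨I₂_s, I₆ × I₁⟩ = ⟨I₂_s, I₇⟩ = β₁`.
  rw [beta2, h3, inner_add_left, inner_cross_left (deriv (I1 (γ t)) s), h26, inner_neg_right,
    h.inner_I1_s_I4 ht hs, real_inner_comm, ← inner_cross_left, h61, beta1, real_inner_comm,
    neg_neg]

theorem inner_I6_s_I3 (h : IsBinormalFlow J S γ) (ht : t ∈ J) (hs : s ∈ S) :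
    inner ℝ (deriv (I6 (γ t)) s) (I3 (γ t) s) = -beta2 (γ t) s := by
  rw [inner_deriv_eq_neg h.isOpen_right hs (h.hasDerivAt_I6 ht hs) (h.hasDerivAt_I3 ht hs)
    (fun σ hσ => (real_inner_comm _ _).trans (h.isG2Triple ht hσ).inner_ab_bc), beta2,
    real_inner_comm]

/-- In `I₆_s = I₂ × I₄_s + I₂_s × I₄` the first term is a multiple of `I₃`, orthogonal to `I₇`; the
second pairs to `⟨I₂_s, I₄ × I₇⟩ = ⟨I₂_s, I₃⟩`. -/
theorem inner_I6_s_I7 (h : IsBinormalFlow J S γ) (ht : t ∈ J) (hs : s ∈ S) :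
    inner ℝ (deriv (I6 (γ t)) s) (I7 (γ t) s) = alpha (γ t) s := by
  have g := h.isG2Triple ht hs
  have h6 : deriv (I6 (γ t)) s = _ :=
    (HasDerivAt.cross (h.hasDerivAt_I2 ht hs) (h.hasDerivAt_I4 ht hs)).deriv
  have h47 : cross (I4 (γ t) s) (I7 (γ t) s) = I3 (γ t) s := g.cross_c_abc
  have h37 : inner ℝ (I3 (γ t) s) (I7 (γ t) s) = 0 :=
    (real_inner_comm _ _).trans (inner_cross_self_left _ _)
  rw [h6, inner_add_left, inner_cross_left (deriv (I2 (γ t)) s), h47, cross_smul_right,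
    cross_anticomm, ← I3, real_inner_smul_left, inner_neg_left, h37, alpha]
  ring

end IsBinormalFlow

namespace IsBinormalFlow

variable {J S : Set ℝ} {γ : ℝ → ℝ → ImOct} {t s : ℝ}

/-! ### The flow derivatives of `I₄`, `I₁` and `I₅` -/

theorem flow_eq (h : IsBinormalFlow J S γ) (ht : t ∈ J) (hs : s ∈ S) :
    deriv (fun τ => γ τ s) t = -k1 (γ t) s • I5 (γ t) s := by
  have h4 : deriv (deriv (γ t)) s = k1 (γ t) s • I1 (γ t) s := (h.hasDerivAt_I4 ht hs).deriv
  rw [h.flow t ht s hs, h4, cross_smul_right, cross_anticomm, I5, I4]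
  module

/-- `I₄_t = γ_st = γ_ts`, and the flow reads `γ_t = -k₁ I₅`. -/
theorem I4_t_eq (h : IsBinormalFlow J S γ) (ht : t ∈ J) (hs : s ∈ S) :
    deriv (fun τ => I4 (γ τ) s) t = -deriv (k1 (γ t)) s • I5 (γ t) s
      + (k1 (γ t) s * rho1 (γ t) s) • I1 (γ t) s
      - (k1 (γ t) s * kappa2 (γ t) s) • I6 (γ t) s := by
  have hk : HasDerivAt (fun σ => -k1 (γ t) σ) (-deriv (k1 (γ t)) s) s :=
    (h.smooth_k1.hasDerivAt_right h.isOpen_left h.isOpen_right ht hs).neg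
  refine (h.smooth.deriv_deriv_comm h.isOpen_left h.isOpen_right ht hs).trans ?_
  rw [deriv_congr_on h.isOpen_right (fun σ hσ => h.flow_eq ht hσ) hs,
    (hk.fun_smul (h.hasDerivAt_I5 ht hs)).deriv]
  module

theorem hasDerivAt_I4_t (h : IsBinormalFlow J S γ) (ht : t ∈ J) (hs : s ∈ S) :
    HasDerivAt (fun τ => I4 (γ τ) s) (deriv (fun τ => I4 (γ τ) s) t) t :=
  h.smooth_I4.hasDerivAt_left h.isOpen_left h.isOpen_right ht hs

theorem hasDerivAt_I1_t (h : IsBinormalFlow J S γ) (ht : t ∈ J) (hs : s ∈ S) :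
    HasDerivAt (fun τ => I1 (γ τ) s) (deriv (fun τ => I1 (γ τ) s) t) t :=
  h.smooth_I1.hasDerivAt_left h.isOpen_left h.isOpen_right ht hs

theorem hasDerivAt_I5_t (h : IsBinormalFlow J S γ) (ht : t ∈ J) (hs : s ∈ S) :
    HasDerivAt (fun τ => I5 (γ τ) s) (deriv (fun τ => I5 (γ τ) s) t) t :=
  h.smooth_I5.hasDerivAt_left h.isOpen_left h.isOpen_right ht hs

/-- Compatibility `I₄_st = I₄_ts` paired with `v`, to be used for `v = I₃` and `v = I₇`. The only
surviving terms are `k₁ I₁_t` on one side and `-k₁ κ₂ I₆_s` on the other. -/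
theorem inner_I1_t (h : IsBinormalFlow J S γ) (ht : t ∈ J) (hs : s ∈ S) {v : ImOct}
    (h1 : inner ℝ (I1 (γ t) s) v = 0) (h2 : inner ℝ (I2 (γ t) s) v = 0)
    (h4 : inner ℝ (I4 (γ t) s) v = 0) (h5 : inner ℝ (I5 (γ t) s) v = 0)
    (h6 : inner ℝ (I6 (γ t) s) v = 0) :
    inner ℝ (deriv (fun τ => I1 (γ τ) s) t) v =
      -kappa2 (γ t) s * inner ℝ (deriv (I6 (γ t)) s) v := by
  have hkt : HasDerivAt (fun τ => k1 (γ τ) s) (deriv (fun τ => k1 (γ τ) s) t) t :=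
    h.smooth_k1.hasDerivAt_left h.isOpen_left h.isOpen_right ht hs
  have hk := h.smooth_k1.hasDerivAt_right h.isOpen_left h.isOpen_right ht hs
  have hk' := ((h.smooth_k1.deriv_right h.isOpen_left h.isOpen_right).hasDerivAt_right
    h.isOpen_left h.isOpen_right ht hs).fun_neg
  have hρ := h.smooth_rho1.hasDerivAt_right h.isOpen_left h.isOpen_right ht hs
  have hκ := h.smooth_kappa2.hasDerivAt_right h.isOpen_left h.isOpen_right ht hs
  have hcomm := h.smooth_I4.deriv_deriv_comm h.isOpen_left h.isOpen_right ht hs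
  rw [deriv_congr_on h.isOpen_left (fun τ hτ => (h.hasDerivAt_I4 hτ hs).deriv) ht,
    deriv_congr_on h.isOpen_right (fun σ hσ => h.I4_t_eq ht hσ) hs,
    (hkt.fun_smul (h.hasDerivAt_I1_t ht hs)).deriv,
    (((hk'.fun_smul (h.hasDerivAt_I5 ht hs)).fun_add
      ((hk.fun_mul hρ).fun_smul (h.hasDerivAt_I1 ht hs))).fun_sub
      ((hk.fun_mul hκ).fun_smul (h.hasDerivAt_I6 ht hs))).deriv] at hcomm
  have := congrArg (fun w => inner ℝ w v) hcomm
  simp only [inner_add_left, inner_sub_left, real_inner_smul_left, h1, h2, h4, h5, h6] at this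
  refine mul_left_cancel₀ (h.k1_ne t ht s hs) ?_
  linear_combination this

theorem I5_t_eq (h : IsBinormalFlow J S γ) (ht : t ∈ J) (hs : s ∈ S) :
    deriv (fun τ => I5 (γ τ) s) t = deriv (k1 (γ t)) s • I4 (γ t) s
      + (k1 (γ t) s * kappa2 (γ t) s) • I7 (γ t) s
      + cross (deriv (fun τ => I1 (γ τ) s) t) (I4 (γ t) s) := by
  have g := h.isG2Triple ht hs
  have h5 : deriv (fun τ => I5 (γ τ) s) t = _ :=
    (HasDerivAt.cross (h.hasDerivAt_I1_t ht hs) (h.hasDerivAt_I4_t ht hs)).deriv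
  have h15 : cross (I1 (γ t) s) (I5 (γ t) s) = -I4 (γ t) s := g.cross_a_ac
  have h16 : cross (I1 (γ t) s) (I6 (γ t) s) = -I7 (γ t) s := g.cross_a_bc
  rw [h5, h.I4_t_eq ht hs, sub_eq_add_neg, ← neg_smul]
  simp only [cross_add_right, cross_smul_right, cross_self, h15, h16]
  module

/-- Only `I₁_t × I₄` contributes, through `⟨I₁_t, I₄ × I₃⟩ = -⟨I₁_t, I₇⟩`. -/
theorem inner_I5_t_I3 (h : IsBinormalFlow J S γ) (ht : t ∈ J) (hs : s ∈ S) :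
    inner ℝ (deriv (fun τ => I5 (γ τ) s) t) (I3 (γ t) s) = kappa2 (γ t) s * alpha (γ t) s := by
  have g := h.isG2Triple ht hs
  have h43 : inner ℝ (I4 (γ t) s) (I3 (γ t) s) = 0 := (real_inner_comm _ _).trans g.inner_ab_c
  have h73 : inner ℝ (I7 (γ t) s) (I3 (γ t) s) = 0 := inner_cross_self_left _ _
  have h1 := h.inner_I1_t ht hs ((real_inner_comm _ _).trans g.inner_abc_a)
    ((real_inner_comm _ _).trans g.inner_abc_b)
    ((real_inner_comm _ _).trans (inner_cross_self_right _ _))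
    ((real_inner_comm _ _).trans g.inner_abc_ac) ((real_inner_comm _ _).trans g.inner_abc_bc)
  rw [← I3, ← I7, h.inner_I6_s_I7 ht hs] at h1
  rw [h.I5_t_eq ht hs, inner_add_left, inner_add_left, real_inner_smul_left,
    real_inner_smul_left, h43, h73, inner_cross_left, cross_anticomm, ← I7, inner_neg_right, h1]
  ring

/-- The summand `k₁ κ₂` comes from `I₁ × I₄_t`, and `κ₂ β₂` from `⟨I₁_t, I₄ × I₇⟩ = ⟨I₁_t, I₃⟩`. -/
theorem inner_I5_t_I7 (h : IsBinormalFlow J S γ) (ht : t ∈ J) (hs : s ∈ S) :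
    inner ℝ (deriv (fun τ => I5 (γ τ) s) t) (I7 (γ t) s) =
      kappa2 (γ t) s * (k1 (γ t) s + beta2 (γ t) s) := by
  have g := h.isG2Triple ht hs
  have h47 : inner ℝ (I4 (γ t) s) (I7 (γ t) s) = 0 :=
    (real_inner_comm _ _).trans (inner_cross_self_right _ _)
  have h77 : inner ℝ (I7 (γ t) s) (I7 (γ t) s) = 1 := g.inner_abc_abc
  have c47 : cross (I4 (γ t) s) (I7 (γ t) s) = I3 (γ t) s := g.cross_c_abc
  have h1 := h.inner_I1_t ht hs ((real_inner_comm _ _).trans (inner_cross_self_left _ _))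
    ((real_inner_comm _ _).trans (inner_cross_self_right _ _))
    ((real_inner_comm _ _).trans g.inner_ab_c)
    ((real_inner_comm _ _).trans g.inner_ab_ac) ((real_inner_comm _ _).trans g.inner_ab_bc)
  rw [← I3, h.inner_I6_s_I3 ht hs] at h1
  rw [h.I5_t_eq ht hs, inner_add_left, inner_add_left, real_inner_smul_left,
    real_inner_smul_left, h47, h77, inner_cross_left, c47, h1]
  ring

/-! ### Normal fields on which the second fundamental form vanishes -/

theorem frameE_two (h : IsBinormalFlow J S γ) (ht : t ∈ J) (hs : s ∈ S) :
    frameE γ 2 t s = -I5 (γ t) s := by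
  rw [frameE, partialT, h.flow_eq ht hs, neg_smul, smul_neg, inv_smul_smul₀ (h.k1_ne t ht s hs)]

theorem alongE_one_one (h : IsBinormalFlow J S γ) (ht : t ∈ J) (hs : s ∈ S) :
    alongE γ 1 (frameE γ 1) t s = k1 (γ t) s • I1 (γ t) s :=
  (h.hasDerivAt_I4 ht hs).deriv

theorem alongE_two_one (t s : ℝ) :
    alongE γ 2 (frameE γ 1) t s = (k1 (γ t) s)⁻¹ • deriv (fun τ => I4 (γ τ) s) t :=
  rfl

theorem alongE_one_two (h : IsBinormalFlow J S γ) (ht : t ∈ J) (hs : s ∈ S) :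
    alongE γ 1 (frameE γ 2) t s = -deriv (I5 (γ t)) s := by
  rw [alongE, partialS, deriv_congr_on h.isOpen_right (fun σ hσ => h.frameE_two ht hσ) hs,
    deriv.fun_neg]

theorem alongE_two_two (h : IsBinormalFlow J S γ) (ht : t ∈ J) (hs : s ∈ S) :
    alongE γ 2 (frameE γ 2) t s = -((k1 (γ t) s)⁻¹ • deriv (fun τ => I5 (γ τ) s) t) := by
  rw [alongE, partialT, deriv_congr_on h.isOpen_left (fun τ hτ => h.frameE_two hτ hs) ht,
    deriv.fun_neg, smul_neg]

end IsBinormalFlow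

/-- A smooth normal field `X` that is orthogonal to `I₁`, `I₆` and `∂I₅/∂t`. -/
structure IsNullNormal (J S : Set ℝ) (γ X : ℝ → ℝ → ImOct) : Prop where
  smooth : SmoothRect J S X
  inner_I1 : ∀ t ∈ J, ∀ s ∈ S, inner ℝ (I1 (γ t) s) (X t s) = 0
  inner_I4 : ∀ t ∈ J, ∀ s ∈ S, inner ℝ (I4 (γ t) s) (X t s) = 0
  inner_I5 : ∀ t ∈ J, ∀ s ∈ S, inner ℝ (I5 (γ t) s) (X t s) = 0
  inner_I6 : ∀ t ∈ J, ∀ s ∈ S, inner ℝ (I6 (γ t) s) (X t s) = 0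
  inner_I5_t : ∀ t ∈ J, ∀ s ∈ S, inner ℝ (deriv (fun τ => I5 (γ τ) s) t) (X t s) = 0

namespace IsNullNormal

variable {J S : Set ℝ} {γ X : ℝ → ℝ → ImOct} {t s : ℝ}

theorem congr (hX : IsNullNormal J S γ X) {Y : ℝ → ℝ → ImOct}
    (h : ∀ t ∈ J, ∀ s ∈ S, Y t s = X t s) : IsNullNormal J S γ Y where
  smooth := hX.smooth.congr h
  inner_I1 t ht s hs := by rw [h t ht s hs, hX.inner_I1 t ht s hs]
  inner_I4 t ht s hs := by rw [h t ht s hs, hX.inner_I4 t ht s hs]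
  inner_I5 t ht s hs := by rw [h t ht s hs, hX.inner_I5 t ht s hs]
  inner_I6 t ht s hs := by rw [h t ht s hs, hX.inner_I6 t ht s hs]
  inner_I5_t t ht s hs := by rw [h t ht s hs, hX.inner_I5_t t ht s hs]

theorem inner_I4_t (hX : IsNullNormal J S γ X) (h : IsBinormalFlow J S γ) (ht : t ∈ J)
    (hs : s ∈ S) : inner ℝ (deriv (fun τ => I4 (γ τ) s) t) (X t s) = 0 := by
  simp [h.I4_t_eq ht hs, inner_add_left, inner_sub_left, real_inner_smul_left,
    hX.inner_I1 t ht s hs, hX.inner_I5 t ht s hs, hX.inner_I6 t ht s hs]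

theorem inner_I5_s (hX : IsNullNormal J S γ X) (h : IsBinormalFlow J S γ) (ht : t ∈ J)
    (hs : s ∈ S) : inner ℝ (deriv (I5 (γ t)) s) (X t s) = 0 := by
  simp [(h.hasDerivAt_I5 ht hs).deriv, inner_add_left, real_inner_smul_left,
    hX.inner_I1 t ht s hs, hX.inner_I6 t ht s hs]

theorem inner_alongE (hX : IsNullNormal J S γ X) (h : IsBinormalFlow J S γ) (ht : t ∈ J)
    (hs : s ∈ S) {i j : ℕ} (hi : i ∈ ({1, 2} : Set ℕ)) (hj : j ∈ ({1, 2} : Set ℕ)) :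
    inner ℝ (alongE γ j (frameE γ i) t s) (X t s) = 0 := by
  rcases hi with rfl | rfl <;> rcases hj with rfl | rfl
  · rw [h.alongE_one_one ht hs, real_inner_smul_left, hX.inner_I1 t ht s hs, mul_zero]
  · rw [IsBinormalFlow.alongE_two_one, real_inner_smul_left, hX.inner_I4_t h ht hs, mul_zero]
  · rw [h.alongE_one_two ht hs, inner_neg_left, hX.inner_I5_s h ht hs, neg_zero]
  · rw [h.alongE_two_two ht hs, inner_neg_left, real_inner_smul_left,
      hX.inner_I5_t t ht s hs, mul_zero, neg_zero]

/-- Moving the derivative from `X` onto `I₄` and `I₅` shows that `X_s` has no tangential part, so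
the projection does nothing. -/
theorem normalDS_eq (hX : IsNullNormal J S γ X) (h : IsBinormalFlow J S γ) (ht : t ∈ J)
    (hs : s ∈ S) : normalDS γ X t s = partialS X t s := by
  have hXs := hX.smooth.hasDerivAt_right h.isOpen_left h.isOpen_right ht hs
  have h4 : inner ℝ (partialS X t s) (I4 (γ t) s) = 0 := by
    have := inner_deriv_eq_neg h.isOpen_right hs (h.hasDerivAt_I4 ht hs) hXs
      (fun σ hσ => hX.inner_I4 t ht σ hσ)
    rw [real_inner_smul_left, hX.inner_I1 t ht s hs, mul_zero, zero_eq_neg] at this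
    exact (real_inner_comm _ _).trans this
  have h5 : inner ℝ (partialS X t s) (I5 (γ t) s) = 0 := by
    have := inner_deriv_eq_neg h.isOpen_right hs (h.hasDerivAt_I5 ht hs) hXs
      (fun σ hσ => hX.inner_I5 t ht σ hσ)
    rw [← (h.hasDerivAt_I5 ht hs).deriv, hX.inner_I5_s h ht hs, zero_eq_neg] at this
    exact (real_inner_comm _ _).trans this
  have h1 : frameE γ 1 t s = I4 (γ t) s := rfl
  rw [normalDS, normalPart, h.frameE_two ht hs, h1, h4, inner_neg_right, h5]
  simp

theorem normalDT_eq (hX : IsNullNormal J S γ X) (h : IsBinormalFlow J S γ) (ht : t ∈ J)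
    (hs : s ∈ S) : normalDT γ X t s = partialT X t s := by
  have hXt := hX.smooth.hasDerivAt_left h.isOpen_left h.isOpen_right ht hs
  have h4 : inner ℝ (partialT X t s) (I4 (γ t) s) = 0 := by
    have := inner_deriv_eq_neg h.isOpen_left ht (h.hasDerivAt_I4_t ht hs) hXt
      (fun τ hτ => hX.inner_I4 τ hτ s hs)
    rw [hX.inner_I4_t h ht hs, zero_eq_neg] at this
    exact (real_inner_comm _ _).trans this
  have h5 : inner ℝ (partialT X t s) (I5 (γ t) s) = 0 := by
    have := inner_deriv_eq_neg h.isOpen_left ht (h.hasDerivAt_I5_t ht hs) hXt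
      (fun τ hτ => hX.inner_I5 τ hτ s hs)
    rw [hX.inner_I5_t t ht s hs, zero_eq_neg] at this
    exact (real_inner_comm _ _).trans this
  have h1 : frameE γ 1 t s = I4 (γ t) s := rfl
  rw [normalDT, normalPart, h.frameE_two ht hs, h1, h4, inner_neg_right, h5]
  simp

theorem normalCurvature_eq_zero (hX : IsNullNormal J S γ X) (h : IsBinormalFlow J S γ)
    (ht : t ∈ J) (hs : s ∈ S) : normalCurvature γ X t s = 0 := by
  -- Since the projections act trivially on the whole open rectangle, they may be dropped under the
  -- outer derivative.
  have h1 : partialT (normalDS γ X) t s = partialS (normalDT γ X) t s := by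
    rw [partialT, partialS, deriv_congr_on h.isOpen_left (fun τ hτ => hX.normalDS_eq h hτ hs) ht,
      deriv_congr_on h.isOpen_right (fun σ hσ => hX.normalDT_eq h ht hσ) hs]
    exact hX.smooth.deriv_deriv_comm h.isOpen_left h.isOpen_right ht hs
  rw [normalCurvature, normalDT, normalDS, h1, sub_self]

end IsNullNormal

/-! ### The functions `φ₂`, `φ₃` and the rotated frame -/

theorem norm_phase (x : ℝ) : ‖(1 / (Real.sqrt 2 : ℂ)) * Complex.exp (-Complex.I * (x : ℂ))‖ =
    1 / Real.sqrt 2 := by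
  have h : -Complex.I * (x : ℂ) = ((-x : ℝ) : ℂ) * Complex.I := by push_cast; ring
  rw [norm_mul, h, Complex.norm_exp_ofReal_mul_I, mul_one, norm_div, norm_one,
    Complex.norm_real, Real.norm_of_nonneg (Real.sqrt_nonneg 2)]

/-- The phases have constant modulus `1/√2`, whatever the integrals are. Hence `φ₂ ≠ 0` amounts to
`κ₂ ≠ 0`, and the `|φ₂|` in `θ` is `κ₂`. -/
theorem norm_phi2 (c : ℝ → ImOct) (s₀ s : ℝ) : ‖phi2 c s₀ s‖ = kappa2 c s := by
  have hr : ‖rPhase c s₀ s‖ = 1 / Real.sqrt 2 := norm_phase _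
  have hq : ‖qPhase c s₀ s‖ = 1 / Real.sqrt 2 := norm_phase _
  rw [phi2, norm_mul, norm_mul, norm_mul, RCLike.norm_conj, hr, hq, Complex.norm_real,
    Real.norm_of_nonneg (show 0 ≤ kappa2 c s from Real.sqrt_nonneg _), Complex.norm_ofNat]
  field_simp
  rw [Real.sq_sqrt zero_le_two, mul_comm]

theorem alpha_eq_zero_and_beta_of_phi3 {c : ℝ → ImOct} {s₀ s : ℝ} (h : phi3 c s₀ s = 0) :
    alpha c s = 0 ∧ beta1 c s + beta2 c s = 0 := by
  have h2 : Real.sqrt 2 ≠ 0 := by positivity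
  have hr : rPhase c s₀ s ≠ 0 := norm_ne_zero_iff.mp
    (by rw [rPhase, norm_phase]; positivity)
  have hq : qPhase c s₀ s ≠ 0 := norm_ne_zero_iff.mp
    (by rw [qPhase, norm_phase]; positivity)
  have hz := (mul_eq_zero.mp h).resolve_left (mul_ne_zero (mul_ne_zero
    (neg_ne_zero.mpr (Complex.ofReal_ne_zero.mpr h2)) (pow_ne_zero 2 hq)) hr)
  have hre := congrArg Complex.re hz
  have him := congrArg Complex.im hz
  simp at hre him
  exact ⟨hre, him⟩

variable {J S : Set ℝ} {γ : ℝ → ℝ → ImOct}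

theorem isNullNormal_I3 (h : IsBinormalFlow J S γ)
    (hα : ∀ t ∈ J, ∀ s ∈ S, alpha (γ t) s = 0) :
    IsNullNormal J S γ fun t s => I3 (γ t) s where
  smooth := h.smooth_I3
  inner_I1 t ht s hs := (real_inner_comm _ _).trans (inner_cross_self_left _ _)
  inner_I4 t ht s hs := (real_inner_comm _ _).trans (h.isG2Triple ht hs).inner_ab_c
  inner_I5 t ht s hs := (real_inner_comm _ _).trans (h.isG2Triple ht hs).inner_ab_ac
  inner_I6 t ht s hs := (real_inner_comm _ _).trans (h.isG2Triple ht hs).inner_ab_bc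
  inner_I5_t t ht s hs := by rw [h.inner_I5_t_I3 ht hs, hα t ht s hs, mul_zero]

/-- `h⁴₂₂` in terms of the frame. -/
theorem secondForm_four (h : IsBinormalFlow J S γ) {t s : ℝ} (ht : t ∈ J) (hs : s ∈ S) :
    secondForm γ (frameE γ) 4 2 2 t s =
      -1 * ((k1 (γ t) s)⁻¹ • inner ℝ (deriv (fun τ => I5 (γ τ) s) t) (I2 (γ t) s)) := by
  rw [secondForm, h.alongE_two_two ht hs, inner_neg_left, real_inner_smul_left, smul_eq_mul,
    neg_one_mul]
  rfl

theorem smooth_secondForm_four (h : IsBinormalFlow J S γ) :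
    SmoothRect J S (secondForm γ (frameE γ) 4 2 2) :=
  (((h.smooth_k1.inv h.k1_ne).smul ((h.smooth_I5.deriv_left h.isOpen_left h.isOpen_right).inner
    h.smooth_I2)).const_mul (-1)).congr fun _ ht _ hs => secondForm_four h ht hs

/-- The sine of an arccosine is nonnegative, so positivity of `y` fixes the sign. -/
theorem cos_sin_arccos_div_sqrt (x : ℝ) {y : ℝ} (hy : 0 < y) :
    Real.cos (Real.arccos (x / Real.sqrt (x ^ 2 + y ^ 2))) = x / Real.sqrt (x ^ 2 + y ^ 2) ∧
    Real.sin (Real.arccos (x / Real.sqrt (x ^ 2 + y ^ 2))) = y / Real.sqrt (x ^ 2 + y ^ 2) := by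
  have hpos : 0 < x ^ 2 + y ^ 2 := by positivity
  have hR : 0 < Real.sqrt (x ^ 2 + y ^ 2) := Real.sqrt_pos.mpr hpos
  have hsq : Real.sqrt (x ^ 2 + y ^ 2) ^ 2 = x ^ 2 + y ^ 2 := Real.sq_sqrt hpos.le
  have hle : |x| ≤ Real.sqrt (x ^ 2 + y ^ 2) := Real.abs_le_sqrt (by nlinarith)
  constructor
  · refine Real.cos_arccos ?_ ?_
    · rw [le_div_iff₀ hR]; linarith [neg_abs_le x]
    · rw [div_le_one hR]; exact (le_abs_self x).trans hle
  · rw [Real.sin_arccos]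
    have : 1 - (x / Real.sqrt (x ^ 2 + y ^ 2)) ^ 2 = (y / Real.sqrt (x ^ 2 + y ^ 2)) ^ 2 := by
      rw [div_pow, div_pow, hsq]
      field_simp
      ring
    rw [this, Real.sqrt_sq (by positivity)]

theorem isNullNormal_frameRot_seven (h : IsBinormalFlow J S γ) (s₀ : ℝ)
    (hβ : ∀ t ∈ J, ∀ s ∈ S, beta1 (γ t) s + beta2 (γ t) s = 0) :
    IsNullNormal J S γ (frameRot γ s₀ 7) := by
  have hκ : ∀ t ∈ J, ∀ s ∈ S, 0 < kappa2 (γ t) s := fun t ht s hs =>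
    lt_of_le_of_ne (Real.sqrt_nonneg _) (h.kappa2_ne t ht s hs).symm
  set H := secondForm γ (frameE γ) 4 2 2 with hH
  have hR : ∀ t ∈ J, ∀ s ∈ S, Real.sqrt (H t s ^ 2 + (3 / 2 * kappa2 (γ t) s) ^ 2) ≠ 0 :=
    fun t ht s hs => by have := hκ t ht s hs; positivity
  have hsR : SmoothRect J S fun t s => Real.sqrt (H t s ^ 2 + (3 / 2 * kappa2 (γ t) s) ^ 2) :=
    (((smooth_secondForm_four h).pow 2).add ((h.smooth_kappa2.const_mul (3 / 2)).pow 2)).sqrt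
      fun t ht s hs => by have := hκ t ht s hs; positivity
  -- `cos θ` and `sin θ` are replaced by explicit quotients: these are visibly smooth, so no
  -- differentiability of `arccos` is needed.
  have key : IsNullNormal J S γ fun t s =>
      ((3 / 2 * kappa2 (γ t) s) / Real.sqrt (H t s ^ 2 + (3 / 2 * kappa2 (γ t) s) ^ 2)) •
          I2 (γ t) s
        + (H t s / Real.sqrt (H t s ^ 2 + (3 / 2 * kappa2 (γ t) s) ^ 2)) • I7 (γ t) s := by
    refine ⟨(((h.smooth_kappa2.const_mul (3 / 2)).div hsR hR).smul h.smooth_I2).add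
      (((smooth_secondForm_four h).div hsR hR).smul h.smooth_I7), ?_, ?_, ?_, ?_, ?_⟩ <;>
      intro t ht s hs <;> have g := h.isG2Triple ht hs <;>
      rw [inner_add_right, real_inner_smul_right, real_inner_smul_right]
    · have e2 : inner ℝ (I1 (γ t) s) (I2 (γ t) s) = 0 := g.ab
      have e7 : inner ℝ (I1 (γ t) s) (I7 (γ t) s) = 0 :=
        (real_inner_comm _ _).trans g.inner_abc_a
      rw [e2, e7, mul_zero, mul_zero, add_zero]
    · have e2 : inner ℝ (I4 (γ t) s) (I2 (γ t) s) = 0 := (real_inner_comm _ _).trans g.bc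
      have e7 : inner ℝ (I4 (γ t) s) (I7 (γ t) s) = 0 :=
        (real_inner_comm _ _).trans (inner_cross_self_right _ _)
      rw [e2, e7, mul_zero, mul_zero, add_zero]
    · have e2 : inner ℝ (I5 (γ t) s) (I2 (γ t) s) = 0 := (real_inner_comm _ _).trans g.b_ac
      have e7 : inner ℝ (I5 (γ t) s) (I7 (γ t) s) = 0 :=
        (real_inner_comm _ _).trans g.inner_abc_ac
      rw [e2, e7, mul_zero, mul_zero, add_zero]
    · have e2 : inner ℝ (I6 (γ t) s) (I2 (γ t) s) = 0 := inner_cross_self_left _ _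
      have e7 : inner ℝ (I6 (γ t) s) (I7 (γ t) s) = 0 :=
        (real_inner_comm _ _).trans g.inner_abc_bc
      rw [e2, e7, mul_zero, mul_zero, add_zero]
    · have hk := h.k1_ne t ht s hs
      have e2 : inner ℝ (deriv (fun τ => I5 (γ τ) s) t) (I2 (γ t) s) = -(k1 (γ t) s * H t s) := by
        rw [hH, secondForm_four h ht hs, smul_eq_mul]
        field_simp
      -- This turns `k₁ + β₂` into `(3/2) k₁`, the source of the factor `9/4` in `θ`.
      have e7 : beta2 (γ t) s = k1 (γ t) s / 2 := by
        linarith [h.beta2_eq ht hs, hβ t ht s hs]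
      rw [e2, h.inner_I5_t_I7 ht hs, e7]
      ring
  refine key.congr fun t ht s hs => ?_
  have hth : theta γ s₀ t s = Real.arccos
      (H t s / Real.sqrt (H t s ^ 2 + (3 / 2 * kappa2 (γ t) s) ^ 2)) := by
    rw [theta, norm_phi2, ← hH, mul_pow]
    norm_num
  obtain ⟨hc, hsin⟩ := cos_sin_arccos_div_sqrt (H t s)
    (show 0 < 3 / 2 * kappa2 (γ t) s by have := hκ t ht s hs; positivity)
  rw [frameRot, hth, hc, hsin]
  rfl

end G2Flow

end

theorem mainTheorem7 (J S : Set ℝ) (hJ : IsOpen J) (hJc : J.OrdConnected)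
    (hS : IsOpen S) (hSc : S.OrdConnected) (s₀ : ℝ) (hs₀ : s₀ ∈ S)
    (γ : ℝ → ℝ → G2Flow.ImOct)
    (hsmooth : ContDiffOn ℝ ∞ (Function.uncurry γ) (J ×ˢ S))
    (hunit : ∀ t ∈ J, ∀ s ∈ S, ‖G2Flow.partialS γ t s‖ = 1)
    (hk1 : ∀ t ∈ J, ∀ s ∈ S, 0 < G2Flow.k1 (γ t) s)
    (hflow : ∀ t ∈ J, ∀ s ∈ S, G2Flow.partialT γ t s =
      G2Flow.cross (G2Flow.partialS γ t s) (G2Flow.partialS (G2Flow.partialS γ) t s))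
    (hphi2 : ∀ t ∈ J, ∀ s ∈ S, G2Flow.phi2 (γ t) s₀ s ≠ 0)
    (hphi3 : ∀ t ∈ J, ∀ s ∈ S, G2Flow.phi3 (γ t) s₀ s = 0) :
    ∀ t ∈ J, ∀ s ∈ S, ∀ α ∈ ({6, 7} : Set ℕ),
      (∀ i ∈ ({1, 2} : Set ℕ), ∀ j ∈ ({1, 2} : Set ℕ),
        G2Flow.secondForm γ (G2Flow.frameRot γ s₀) α i j t s = 0) ∧
      G2Flow.normalCurvature γ (G2Flow.frameRot γ s₀ α) t s = 0 := by
  have h : G2Flow.IsBinormalFlow J S γ :=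
    { isOpen_left := hJ
      isOpen_right := hS
      smooth := hsmooth
      unit := hunit
      k1_pos := hk1
      flow := hflow
      kappa2_ne := fun t ht s hs h0 => hphi2 t ht s hs
        (norm_eq_zero.mp ((G2Flow.norm_phi2 _ _ _).trans h0)) }
  have key : ∀ α ∈ ({6, 7} : Set ℕ), G2Flow.IsNullNormal J S γ (G2Flow.frameRot γ s₀ α) := by
    rintro α (rfl | rfl)
    · exact G2Flow.isNullNormal_I3 h fun t ht s hs =>
        (G2Flow.alpha_eq_zero_and_beta_of_phi3 (hphi3 t ht s hs)).1
    · exact G2Flow.isNullNormal_frameRot_seven h s₀ fun t ht s hs =>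
        (G2Flow.alpha_eq_zero_and_beta_of_phi3 (hphi3 t ht s hs)).2
  intro t ht s hs α hα
  refine ⟨fun i hi j hj => ?_, (key α hα).normalCurvature_eq_zero h ht hs⟩
  have := (key α hα).inner_alongE h ht hs hi hj
  -- For a concrete tangent label the rotated frame unfolds to the original one.
  rcases hi with rfl | rfl <;> exact this
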